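/- A linear decision tree on real inputs $v=(v_1,\dots,v_m)$ with $p$ real outputs is a finite binary tree in which every internal node tests whether $\ell(v)\le 0$ for an affine function $\ell:\mathbb{R}^m\to\mathbb{R}$ attached to it (with one child for each answer), and every leaf carries $p$ affine functions of $v$, whose values at $v$ are the outputs for all inputs $v$ that lead to this leaf. Its running time is its depth, that is, the maximum number of tests on a root-to-leaf path. The model is nonuniform: a different tree may be used for each input length. For vectors $x=(x_0,\dots,x_{n-1})$ and $y=(y_0,\dots,y_{n-1})$ in $\mathbb{R}^n$, their $(\min,-)$ convolution is the vector $(z_0,\dots,z_{n-1})$ with $z_k=\min_{0\le i\le k}\,(x_i-y_{k-i})$. **Theorem.** The $(\min,-)$ convolution of two vectors of length $n$ can be computed in $O(n\sqrt n)$ time in the nonuniform linear decision tree model. That is, there is an absolute constant $C$ such that for every $n$ there is a linear decision tree with $2n$ real inputs and depth at most $C\,n\sqrt n$ which, for all $x,y\in\mathbb{R}^n$, outputs all $n$ entries of the $(\min,-)$ convolution of $x$ and $y$. -/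

import Mathlib

/-- A real affine function of the input variables `(v i)`, `i : ι`. -/
abbrev AffineForm (ι : Type) : Type := (ι → ℝ) →ᵃ[ℝ] ℝ

/-- Linear decision trees on real inputs indexed by `ι`, with real outputs indexed by `κ`.
An internal node tests the sign of an affine function of the input; a leaf gives every output
entry as an affine function of the input. -/
inductive LinearDecisionTree (ι κ : Type) : Type
  | leaf (out : κ → AffineForm ι) : LinearDecisionTree ι κ
  | node (query : AffineForm ι) (ifNonpos ifPos : LinearDecisionTree ι κ) :
      LinearDecisionTree ι κ

namespace LinearDecisionTree

/-- The running time in this model: the largest number of tests on a root-to-leaf path. -/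
def depth {ι κ : Type} : LinearDecisionTree ι κ → ℕ
  | leaf _ => 0
  | node _ l r => max (depth l) (depth r) + 1

/-- The output of the tree on the input `v`. -/
noncomputable def eval {ι κ : Type} : LinearDecisionTree ι κ → (ι → ℝ) → κ → ℝ
  | leaf out, v => fun k => out k v
  | node q l r, v => if q v ≤ 0 then eval l v else eval r v

end LinearDecisionTree

/-- The (min,-) convolution of two vectors of length `n`: its entry `k` (for `k = 0, …, n - 1`) is
the minimum of `x i - y (k - i)` over `i = 0, …, k`. -/
noncomputable def minSubConvolution {n : ℕ} (x y : Fin n → ℝ) (k : Fin n) : ℝ :=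
  (Finset.Iic k).inf' ⟨k, Finset.mem_Iic.mpr le_rfl⟩
    fun i => x i - y ⟨k.val - i.val, (Nat.sub_le _ _).trans_lt k.isLt⟩

/-! Fredman's trick: `x i - y (k - i) ≤ x j - y (k - j)` iff `x i - x j ≤ y (k - i) - y (k - j)`, so
the order of the differences at distance below `d` decides every comparison between two candidates
of one block of length `d`. There are `N = 2nd` such differences, with padding. They can be sorted
by `O(N + log W)` tests, where `W` counts the orders that occur (`ComputableOn.of_sorted`); by
Sauer–Shelah `W ≤ (N ^ 2 + 1) ^ (2n)` (`patternCount_le`). The minimum of each block is then known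
without tests, and each output is the least of at most `n / d + 1` block minima. With `d` near `√n`
every cost is `O(n√n)`. -/

/-- Some linear decision tree of depth at most `d` computes `F` on all inputs in `R`. -/
def ComputableOn {ι κ : Type} (F : (ι → ℝ) → κ → ℝ) (R : Set (ι → ℝ)) (d : ℕ) : Prop :=
  ∃ T : LinearDecisionTree ι κ, (∀ v ∈ R, T.eval v = F v) ∧ T.depth ≤ d

/-! ### Decision trees restricted to regions of inputs -/

namespace ComputableOn

variable {ι κ : Type} {F : (ι → ℝ) → κ → ℝ} {R S : Set (ι → ℝ)} {d e : ℕ}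

theorem mono (h : ComputableOn F S d) (hRS : R ⊆ S) (hde : d ≤ e) : ComputableOn F R e := by
  obtain ⟨T, hT, hd⟩ := h
  exact ⟨T, fun v hv => hT v (hRS hv), hd.trans hde⟩

theorem of_leaf (out : κ → AffineForm ι) (h : ∀ v ∈ R, ∀ k, out k v = F v k) :
    ComputableOn F R d :=
  ⟨.leaf out, fun v hv => funext fun k => by simpa [LinearDecisionTree.eval] using h v hv k,
    by simp [LinearDecisionTree.depth]⟩

theorem of_empty : ComputableOn F ∅ d :=
  of_leaf (fun _ => 0) (by simp)

/-- Spend one test on the comparison of two linear forms. -/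
theorem of_compare (f g : Module.Dual ℝ (ι → ℝ))
    (hle : ComputableOn F {v ∈ R | f v ≤ g v} d) (hlt : ComputableOn F {v ∈ R | g v < f v} d) :
    ComputableOn F R (d + 1) := by
  obtain ⟨T, hT, hTd⟩ := hle
  obtain ⟨U, hU, hUd⟩ := hlt
  refine ⟨.node (f - g).toAffineMap T U, fun v hv => ?_, ?_⟩
  · by_cases h : f v ≤ g v
    · have h' : (f - g).toAffineMap v ≤ 0 := by simpa using h
      simp only [LinearDecisionTree.eval, if_pos h']
      exact hT v ⟨hv, h⟩
    · have h' : ¬ (f - g).toAffineMap v ≤ 0 := by simpa using h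
      simp only [LinearDecisionTree.eval, if_neg h']
      exact hU v ⟨hv, not_le.mp h⟩
  · simp only [LinearDecisionTree.depth]
    omega

end ComputableOn

theorem Finset.exists_least_of_total {α : Type*} {r : α → α → Prop} (htotal : ∀ a b, r a b ∨ r b a)
    (htrans : ∀ a b c, r a b → r b c → r a c) {s : Finset α} (hs : s.Nonempty) :
    ∃ a ∈ s, ∀ b ∈ s, r a b := by
  classical
  induction hs using Finset.Nonempty.cons_induction with
  | singleton a => exact ⟨a, by simp, by simpa using htotal a a⟩
  | cons a s ha hs ih =>
    obtain ⟨b, hb, hmin⟩ := ih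
    rcases htotal a b with h | h
    · refine ⟨a, by simp, fun c hc => ?_⟩
      rcases Finset.mem_cons.mp hc with rfl | hc
      · exact (htotal c c).elim id id
      · exact htrans _ _ _ h (hmin c hc)
    · refine ⟨b, by simp [hb], fun c hc => ?_⟩
      rcases Finset.mem_cons.mp hc with rfl | hc
      · exact h
      · exact hmin c hc

/-! ### Counting order patterns of linear forms -/

section OrderPatterns

variable {ι κ α : Type}

/-- `f ≤ g` holds at all inputs in `R`. -/
def LEOn (R : Set (ι → ℝ)) (f g : Module.Dual ℝ (ι → ℝ)) : Prop :=
  ∀ v ∈ R, f v ≤ g v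

theorem LEOn.trans {R : Set (ι → ℝ)} {f g h : Module.Dual ℝ (ι → ℝ)} (hfg : LEOn R f g)
    (hgh : LEOn R g h) : LEOn R f h :=
  fun v hv => (hfg v hv).trans (hgh v hv)

theorem LEOn.mono {R S : Set (ι → ℝ)} {f g : Module.Dual ℝ (ι → ℝ)} (h : LEOn S f g)
    (hRS : R ⊆ S) : LEOn R f g :=
  fun v hv => h v (hRS hv)

/-- The order of the values of the forms `f a`, `a ∈ s`, is the same on all of `R`, up to ties. -/
def SortedOn (f : α → Module.Dual ℝ (ι → ℝ)) (s : Set α) (R : Set (ι → ℝ)) : Prop :=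
  ∀ a ∈ s, ∀ b ∈ s, LEOn R (f a) (f b) ∨ LEOn R (f b) (f a)

theorem SortedOn.mono {f : α → Module.Dual ℝ (ι → ℝ)} {s : Set α} {R S : Set (ι → ℝ)}
    (h : SortedOn f s S) (hRS : R ⊆ S) : SortedOn f s R :=
  fun a ha b hb => (h a ha b hb).imp (·.mono hRS) (·.mono hRS)

theorem SortedOn.exists_least {f : α → Module.Dual ℝ (ι → ℝ)} {s : Finset α} {R : Set (ι → ℝ)}
    (h : SortedOn f s R) (hs : s.Nonempty) : ∃ a ∈ s, ∀ b ∈ s, LEOn R (f a) (f b) := by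
  obtain ⟨a, -, ha⟩ := Finset.exists_least_of_total (s := s.attach)
    (r := fun a b : s => LEOn R (f a) (f b)) (fun a b => h a a.2 b b.2)
    (fun _ _ _ => LEOn.trans) (by simpa using hs)
  exact ⟨a, a.2, fun b hb => ha ⟨b, hb⟩ (by simp)⟩

theorem SortedOn.exists_greatest {f : α → Module.Dual ℝ (ι → ℝ)} {s : Finset α}
    {R : Set (ι → ℝ)} (h : SortedOn f s R) (hs : s.Nonempty) :
    ∃ a ∈ s, ∀ b ∈ s, LEOn R (f b) (f a) := by
  obtain ⟨a, -, ha⟩ := Finset.exists_least_of_total (s := s.attach)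
    (r := fun a b : s => LEOn R (f b) (f a)) (fun a b => h b b.2 a a.2)
    (fun _ _ _ hab hbc => hbc.trans hab) (by simpa using hs)
  exact ⟨a, a.2, fun b hb => ha ⟨b, hb⟩ (by simp)⟩

variable [Fintype α]

open Classical in
/-- The set of pairs `(a, b)` with `f a ≤ f b` at the input `v`. -/
noncomputable def orderPattern (f : α → Module.Dual ℝ (ι → ℝ)) (v : ι → ℝ) : Finset (α × α) :=
  Finset.univ.filter fun p => f p.1 v ≤ f p.2 v

/-- The number of order patterns of `f` that occur in `R`. -/
noncomputable def patternCount (f : α → Module.Dual ℝ (ι → ℝ)) (R : Set (ι → ℝ)) : ℕ :=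
  (orderPattern f '' R).ncard

theorem patternCount_mono (f : α → Module.Dual ℝ (ι → ℝ)) {R S : Set (ι → ℝ)} (h : R ⊆ S) :
    patternCount f R ≤ patternCount f S :=
  Set.ncard_le_ncard (Set.image_mono h) (Set.toFinite _)

theorem patternCount_pos (f : α → Module.Dual ℝ (ι → ℝ)) {R : Set (ι → ℝ)} (h : R.Nonempty) :
    0 < patternCount f R :=
  (Set.ncard_pos (Set.toFinite _)).mpr (h.image _)

theorem patternCount_split (f : α → Module.Dual ℝ (ι → ℝ)) (R : Set (ι → ℝ)) (a b : α) :
    patternCount f {v ∈ R | f a v ≤ f b v} + patternCount f {v ∈ R | f b v < f a v} =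
      patternCount f R := by
  unfold patternCount
  rw [← Set.ncard_union_eq ?_ (Set.toFinite _) (Set.toFinite _), ← Set.image_union]
  · congr 2
    ext v
    simp only [Set.mem_union, Set.mem_ofPred_eq]
    have := le_or_gt (f a v) (f b v)
    tauto
  · rw [Set.disjoint_left]
    rintro _ ⟨v, ⟨-, hv⟩, rfl⟩ ⟨w, ⟨-, hw⟩, h⟩
    have : (a, b) ∈ orderPattern f w := by
      rw [h]
      simpa [orderPattern] using hv
    simp only [orderPattern, Finset.mem_filter, Finset.mem_univ, true_and] at this
    exact absurd this (not_le.mpr hw)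

open Classical in
-- More pairs than the dimension force a linear relation with coefficients `c` among the differences
-- `f a - f b`. Shattering yields an input where exactly the differences with `c p > 0` are
-- nonpositive. All terms of the relation are then nonpositive with sum zero, which excludes `c p <
-- 0`; the same holds for `-c`, so `c = 0`.
theorem card_le_of_shatters [Fintype ι] (f : α → Module.Dual ℝ (ι → ℝ))
    {𝒜 : Finset (Finset (α × α))} (h𝒜 : ∀ t ∈ 𝒜, ∃ v, orderPattern f v = t)
    {s : Finset (α × α)} (hs : 𝒜.Shatters s) :
    s.card ≤ Fintype.card ι := by
  by_contra! hcard
  let g : α × α → Module.Dual ℝ (ι → ℝ) := fun p => f p.1 - f p.2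
  have key : ∀ c : s → ℝ, (∀ v, ∑ p, c p * g p v = 0) → ∀ p, 0 ≤ c p := by
    intro c hc
    obtain ⟨t, ht, hst⟩ := hs (t := s.filter fun p => ∃ h : p ∈ s, 0 < c ⟨p, h⟩)
      (Finset.filter_subset _ _)
    obtain ⟨v, rfl⟩ := h𝒜 t ht
    have hmem : ∀ p : s, g p v ≤ 0 ↔ 0 < c p := by
      intro p
      have := Finset.ext_iff.mp hst p
      simp only [Finset.mem_inter, Finset.mem_filter, p.2, true_and, exists_true_left,
        orderPattern, Finset.mem_univ] at this
      simpa [g] using this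
    have hterm : ∀ p ∈ Finset.univ, c p * g p v ≤ 0 := by
      intro p _
      rcases le_or_gt (g p v) 0 with h | h
      · exact mul_nonpos_of_nonneg_of_nonpos ((hmem p).mp h).le h
      · exact mul_nonpos_of_nonpos_of_nonneg (not_lt.mp fun h' => absurd ((hmem p).mpr h')
          (not_le.mpr h)) h.le
    intro p
    by_contra! hp
    have hpos : 0 < g p v := not_le.mp fun h => absurd ((hmem p).mp h) (not_lt.mpr hp.le)
    have := (Finset.sum_eq_zero_iff_of_nonpos hterm).mp (hc v) p (Finset.mem_univ _)
    exact absurd this (mul_neg_of_neg_of_pos hp hpos).ne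
  have hdep : ¬ LinearIndependent ℝ fun p : s => g p := by
    intro h
    have := h.fintype_card_le_finrank
    rw [Subspace.dual_finrank_eq, Module.finrank_fintype_fun_eq_card, Fintype.card_coe] at this
    omega
  rw [Fintype.not_linearIndependent_iff] at hdep
  obtain ⟨c, hc, p, hp⟩ := hdep
  have hsum : ∀ v, ∑ p, c p * g p v = 0 := fun v => by
    simpa using congrArg (fun φ : Module.Dual ℝ (ι → ℝ) => φ v) hc
  have h1 := key c hsum p
  have h2 := key (-c) (fun v => by simpa using hsum v) p
  simp only [Pi.neg_apply] at h2
  exact hp (by linarith)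

theorem sum_choose_le_succ_pow (M m : ℕ) : ∑ k ∈ Finset.Iic m, M.choose k ≤ (M + 1) ^ m := by
  rw [add_pow, ← Nat.range_succ_eq_Iic]
  refine Finset.sum_le_sum fun k hk => ?_
  have hk : k ≤ m := Nat.lt_succ_iff.mp (Finset.mem_range.mp hk)
  calc M.choose k ≤ M ^ k := Nat.choose_le_pow _ _
    _ ≤ M ^ k * 1 ^ (m - k) * m.choose k := by
      simpa using Nat.le_mul_of_pos_right _ (Nat.choose_pos hk)

theorem patternCount_le [Fintype ι] (f : α → Module.Dual ℝ (ι → ℝ)) (R : Set (ι → ℝ)) :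
    patternCount f R ≤ (Fintype.card α ^ 2 + 1) ^ Fintype.card ι := by
  classical
  set 𝒜 : Finset (Finset (α × α)) := (Set.toFinite (orderPattern f '' R)).toFinset with h𝒜
  have hcount : patternCount f R = 𝒜.card := Set.ncard_eq_toFinset_card _ _
  have hvc : 𝒜.vcDim ≤ Fintype.card ι := by
    refine Finset.sup_le fun s hs => card_le_of_shatters f ?_ (Finset.mem_shatterer.mp hs)
    intro t ht
    rw [h𝒜, Set.Finite.mem_toFinset] at ht
    obtain ⟨v, -, rfl⟩ := ht
    exact ⟨v, rfl⟩
  calc patternCount f R ≤ 𝒜.shatterer.card := hcount ▸ 𝒜.card_le_card_shatterer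
    _ ≤ ∑ k ∈ Finset.Iic 𝒜.vcDim, (Fintype.card (α × α)).choose k :=
      Finset.card_shatterer_le_sum_vcDim
    _ ≤ (Fintype.card (α × α) + 1) ^ 𝒜.vcDim := sum_choose_le_succ_pow _ _
    _ ≤ (Fintype.card α ^ 2 + 1) ^ Fintype.card ι := by
      rw [Fintype.card_prod, ← sq]
      exact Nat.pow_le_pow_right (Nat.succ_pos _) hvc

theorem two_mul_log_add_two_le {w W : ℕ} (hw : 0 < w) (h : 2 * w ≤ W) :
    2 * Nat.log 2 w + 2 ≤ 2 * Nat.log 2 W := by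
  have h1 : Nat.log 2 (w * 2) = Nat.log 2 w + 1 := Nat.log_mul_base (by norm_num) hw.ne'
  have h2 : Nat.log 2 (w * 2) ≤ Nat.log 2 W := Nat.log_mono_right (by omega)
  omega

/-! ### Sorting with few tests -/

namespace ComputableOn

variable {F : (ι → ℝ) → κ → ℝ} {f : α → Module.Dual ℝ (ι → ℝ)} {K : ℕ}

/-- Insertion into a sorted list, by a binary search that halves the number of order patterns. -/
theorem insert_sorted (s : Finset α) (a : α) (R : Set (ι → ℝ)) (hs : SortedOn f s R)
    (h : ∀ S ⊆ R, SortedOn f (insert a (s : Set α)) S →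
      ComputableOn F S (K + 2 * Nat.log 2 (patternCount f S))) :
    ComputableOn F R (K + 2 + 2 * Nat.log 2 (patternCount f R)) := by
  classical
  induction hW : patternCount f R using Nat.strong_induction_on generalizing R with
  | _ W ih =>
  -- Halving the number of patterns lowers `2 * log` by two, which pays for the two tests of a
  -- round.
  have hsmall : ∀ S ⊆ R, 2 * patternCount f S ≤ W →
      ComputableOn F S (K + 2 * Nat.log 2 W) := by
    intro S hSR hS
    rcases S.eq_empty_or_nonempty with rfl | hne
    · exact of_empty
    have hpos := patternCount_pos f hne
    refine (ih _ (by omega) S (hs.mono hSR) (fun S' hS' => h S' (hS'.trans hSR)) rfl).mono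
      subset_rfl ?_
    have := two_mul_log_add_two_le hpos hS
    omega
  -- `A` is an initial segment of the sorted forms, `B` the rest. If `f a` is at most the greatest
  -- of `A`, or exceeds the least of `B`, at most half of the patterns survive. Otherwise the place
  -- of `a` is between `A` and `B`.
  let A := s.filter fun b => 2 * patternCount f {v ∈ R | f a v ≤ f b v} ≤ W
  let B := s.filter fun b => ¬ 2 * patternCount f {v ∈ R | f a v ≤ f b v} ≤ W
  have hAB : ∀ b ∈ A, ∀ c ∈ B, LEOn R (f b) (f c) := by
    intro b hb c hc
    simp only [A, B, Finset.mem_filter] at hb hc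
    refine (hs b hb.1 c hc.1).resolve_right fun hcb => hc.2 (le_trans ?_ hb.2)
    exact Nat.mul_le_mul_left 2 (patternCount_mono f fun v hv => ⟨hv.1, hv.2.trans (hcb v hv.1)⟩)
  have hA : SortedOn f (A : Set α) R := fun b hb c hc =>
    hs b (Finset.filter_subset _ _ hb) c (Finset.filter_subset _ _ hc)
  have hB : SortedOn f (B : Set α) R := fun b hb c hc =>
    hs b (Finset.filter_subset _ _ hb) c (Finset.filter_subset _ _ hc)
  have hmid : ComputableOn F {v ∈ R | (∀ b ∈ A, f b v < f a v) ∧ ∀ b ∈ B, f a v ≤ f b v}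
      (K + 2 * Nat.log 2 W) := by
    refine (h _ (Set.sep_subset _ _) ?_).mono subset_rfl ?_
    · have hcmp : ∀ b ∈ s,
          LEOn {v ∈ R | (∀ b ∈ A, f b v < f a v) ∧ ∀ b ∈ B, f a v ≤ f b v} (f b) (f a) ∨
          LEOn {v ∈ R | (∀ b ∈ A, f b v < f a v) ∧ ∀ b ∈ B, f a v ≤ f b v} (f a) (f b) := by
        intro b hb
        by_cases hbA : 2 * patternCount f {v ∈ R | f a v ≤ f b v} ≤ W
        · exact .inl fun v hv => (hv.2.1 b (Finset.mem_filter.mpr ⟨hb, hbA⟩)).le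
        · exact .inr fun v hv => hv.2.2 b (Finset.mem_filter.mpr ⟨hb, hbA⟩)
      rintro b (rfl | hb) c (rfl | hc)
      · exact .inl fun v _ => le_rfl
      · exact (hcmp c hc).symm
      · exact hcmp b hb
      · exact hs.mono (Set.sep_subset _ _) b hb c hc
    · rw [← hW]
      have := Nat.log_mono_right (b := 2) (patternCount_mono f (Set.sep_subset R
        fun v => (∀ b ∈ A, f b v < f a v) ∧ ∀ b ∈ B, f a v ≤ f b v))
      omega
  have hright : ComputableOn F {v ∈ R | ∀ b ∈ A, f b v < f a v} (K + 2 * Nat.log 2 W + 1) := by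
    rcases B.eq_empty_or_nonempty with hBe | hBne
    · refine hmid.mono (fun v hv => ⟨hv.1, hv.2, by simp [hBe]⟩) (Nat.le_succ _)
    obtain ⟨b, hb, hbmin⟩ := hB.exists_least hBne
    refine of_compare (f a) (f b) ?_ ?_
    · exact hmid.mono (fun v hv => ⟨hv.1.1, hv.1.2, fun c hc =>
        hv.2.trans (hbmin c hc v hv.1.1)⟩) le_rfl
    · refine (hsmall {v ∈ R | f b v < f a v} (Set.sep_subset _ _) ?_).mono
        (fun v hv => ⟨hv.1.1, hv.2⟩) le_rfl
      have h1 := patternCount_split f R a b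
      have h2 := (Finset.mem_filter.mp hb).2
      omega
  have hall : ComputableOn F R (K + 2 * Nat.log 2 W + 1 + 1) := by
    rcases A.eq_empty_or_nonempty with hAe | hAne
    · exact hright.mono (fun v hv => ⟨hv, by simp [hAe]⟩) (Nat.le_succ _)
    obtain ⟨b, hb, hbmax⟩ := hA.exists_greatest hAne
    refine of_compare (f a) (f b) ?_ ?_
    · exact (hsmall _ (Set.sep_subset _ _) (Finset.mem_filter.mp hb).2).mono subset_rfl
        (Nat.le_succ _)
    · exact hright.mono (fun v hv => ⟨hv.1, fun c hc => (hbmax c hc v hv.1).trans_lt hv.2⟩) le_rfl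
  exact hall.mono subset_rfl (by omega)

/-- Fredman's theorem: `f` is sorted by `O(N + log W)` tests, where `N` is the number of forms and
`W` the number of their order patterns. -/
theorem of_sorted (h : ∀ R, SortedOn f Set.univ R → ComputableOn F R K) :
    ComputableOn F Set.univ
      (K + 2 * Fintype.card α + 2 * Nat.log 2 (patternCount f Set.univ)) := by
  classical
  -- `s` holds the forms still to be inserted. The logarithm is a potential shared by all
  -- insertions, so it is paid only once.
  have key : ∀ s : Finset α, ∀ R, SortedOn f (↑(sᶜ) : Set α) R →
      ComputableOn F R (K + 2 * s.card + 2 * Nat.log 2 (patternCount f R)) := by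
    intro s
    induction s using Finset.induction_on with
    | empty =>
      intro R hR
      exact (h R (by simpa using hR)).mono subset_rfl (by omega)
    | insert a s ha ih =>
      intro R hR
      rw [Finset.card_insert_of_notMem ha]
      have := insert_sorted (F := F) (K := K + 2 * s.card) _ a R hR fun S _ hS => ih S <| by
        convert hS using 1
        ext b
        by_cases hb : b = a <;> simp [hb, ha]
      exact this.mono subset_rfl (by omega)
  simpa using key Finset.univ Set.univ (by simp [SortedOn])

end ComputableOn

end OrderPatterns

/-! ### Selecting minima -/

namespace ComputableOn

variable {ι κ α : Type} {F : (ι → ℝ) → κ → ℝ} {K : ℕ}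

/-- The least of finitely many forms is found by one test for each of them. -/
theorem of_least (g : α → Module.Dual ℝ (ι → ℝ)) {s : Finset α} (hs : s.Nonempty)
    (R : Set (ι → ℝ))
    (h : ∀ S ⊆ R, (∃ a ∈ s, ∀ b ∈ s, LEOn S (g a) (g b)) → ComputableOn F S K) :
    ComputableOn F R (K + s.card) := by
  classical
  induction hs using Finset.Nonempty.cons_induction generalizing R K with
  | singleton a =>
    exact (h R subset_rfl ⟨a, by simp, by simp [LEOn]⟩).mono subset_rfl (by omega)
  | cons a s ha hs ih =>
    rw [Finset.card_cons, show K + (s.card + 1) = K + 1 + s.card by omega]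
    refine ih R fun S hSR hS => ?_
    obtain ⟨b, hb, hmin⟩ := hS
    refine of_compare (g a) (g b) ?_ ?_
    · refine h _ ((Set.sep_subset _ _).trans hSR) ⟨a, by simp, fun c hc v hv => ?_⟩
      rcases Finset.mem_cons.mp hc with rfl | hc
      · exact le_rfl
      · exact hv.2.trans (hmin c hc v hv.1)
    · refine h _ ((Set.sep_subset _ _).trans hSR) ⟨b, by simp [hb], fun c hc v hv => ?_⟩
      rcases Finset.mem_cons.mp hc with rfl | hc
      · exact hv.2.le
      · exact hmin c hc v hv.1

theorem of_forall_least [Fintype κ] (g : κ → α → Module.Dual ℝ (ι → ℝ)) (s : κ → Finset α)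
    (hs : ∀ k, (s k).Nonempty) (R : Set (ι → ℝ)) {c : ℕ} (hc : ∀ k, (s k).card ≤ c)
    (h : ∀ v ∈ R, ∀ k, ∀ a ∈ s k, (∀ b ∈ s k, g k a v ≤ g k b v) → F v k = g k a v) :
    ComputableOn F R (Fintype.card κ * c) := by
  classical
  -- `t` holds the outputs whose least form is still undetermined.
  have key : ∀ t : Finset κ, ∀ S ⊆ R,
      (∀ k ∉ t, ∃ a ∈ s k, ∀ b ∈ s k, LEOn S (g k a) (g k b)) → ComputableOn F S (t.card * c) := by
    intro t
    induction t using Finset.induction_on with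
    | empty =>
      intro S hSR hS
      choose a ha hmin using fun k => hS k (Finset.notMem_empty k)
      exact of_leaf (fun k => (g k (a k)).toAffineMap) fun v hv k =>
        (h v (hSR hv) k (a k) (ha k) fun b hb => hmin k b hb v hv).symm
    | insert k t hk ih =>
      intro S hSR hS
      rw [Finset.card_insert_of_notMem hk, Nat.succ_mul]
      refine (of_least (g k) (hs k) S fun S' hS' hk' => ih S' (hS'.trans hSR) ?_).mono subset_rfl
        (Nat.add_le_add_left (hc k) _)
      intro l hl
      by_cases hlk : l = k
      · exact hlk ▸ hk'
      · obtain ⟨a, ha, hmin⟩ := hS l (by simp [hlk, hl])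
        exact ⟨a, ha, fun b hb => (hmin b hb).mono hS'⟩
  exact key Finset.univ R subset_rfl (by simp)

end ComputableOn

/-! ### Fredman's trick for the convolution -/

section Convolution

variable {n : ℕ}

/-- The coordinate `v p`, as a linear form. -/
abbrev coord (p : Fin n ⊕ Fin n) : Module.Dual ℝ (Fin n ⊕ Fin n → ℝ) :=
  LinearMap.proj p

/-- The form `x i - y (k - i)` in the input `(x, y)`. -/
def convTerm (k i : Fin n) : Module.Dual ℝ (Fin n ⊕ Fin n → ℝ) :=
  coord (.inl i) - coord (.inr ⟨k.val - i.val, (Nat.sub_le _ _).trans_lt k.isLt⟩)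

/-- The forms `x i - x (i + s)` and `y (i + s) - y i` for `s < d`. -/
def shiftDiff (d : ℕ) : (Fin n × Fin d) ⊕ (Fin n × Fin d) → Module.Dual ℝ (Fin n ⊕ Fin n → ℝ)
  -- The value `0` is padding for shifts out of range; no comparison of candidates uses it.
  | .inl (i, s) => if h : i.val + s.val < n then coord (.inl i) - coord (.inl ⟨i + s, h⟩) else 0
  | .inr (i, s) => if h : i.val + s.val < n then coord (.inr ⟨i + s, h⟩) - coord (.inr i) else 0

theorem minSubConvolution_eq (v : Fin n ⊕ Fin n → ℝ) (k i : Fin n) (hi : i ≤ k)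
    (hmin : ∀ j ≤ k, convTerm k i v ≤ convTerm k j v) :
    minSubConvolution (v ∘ Sum.inl) (v ∘ Sum.inr) k = convTerm k i v :=
  le_antisymm (Finset.inf'_le _ (Finset.mem_Iic.mpr hi))
    (Finset.le_inf' _ _ fun j hj => hmin j (Finset.mem_Iic.mp hj))

/-- Moving the `x` entries to one side and the `y` entries to the other turns the comparison into
one between two members of `shiftDiff d`, both with shift `j - i`. -/
theorem convTerm_total_of_le {d : ℕ} {R : Set (Fin n ⊕ Fin n → ℝ)}
    (hR : SortedOn (shiftDiff d) Set.univ R) {k i j : Fin n} (hij : i ≤ j) (hjk : j ≤ k)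
    (hd : j.val - i.val < d) :
    LEOn R (convTerm k i) (convTerm k j) ∨ LEOn R (convTerm k j) (convTerm k i) := by
  have hij' : i.val ≤ j.val := hij
  have hjk' : j.val ≤ k.val := hjk
  have hkj : k.val - j.val < n := (Nat.sub_le _ _).trans_lt k.isLt
  have h1 : i.val + (j.val - i.val) < n := by omega
  have h2 : k.val - j.val + (j.val - i.val) < n := by omega
  have e1 : (⟨i.val + (j.val - i.val), h1⟩ : Fin n) = j := Fin.ext (by simp; omega)
  have e2 : (⟨k.val - j.val + (j.val - i.val), h2⟩ : Fin n) =
      ⟨k.val - i.val, (Nat.sub_le _ _).trans_lt k.isLt⟩ := Fin.ext (by simp; omega)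
  have hx : ∀ v, shiftDiff d (.inl (i, ⟨j.val - i.val, hd⟩)) v = v (.inl i) - v (.inl j) := by
    intro v
    simp only [shiftDiff, dif_pos h1, e1]
    simp
  have hy : ∀ v, shiftDiff d (.inr (⟨k.val - j.val, hkj⟩, ⟨j.val - i.val, hd⟩)) v =
      v (.inr ⟨k.val - i.val, (Nat.sub_le _ _).trans_lt k.isLt⟩) -
        v (.inr ⟨k.val - j.val, hkj⟩) := by
    intro v
    simp only [shiftDiff, dif_pos h2, e2]
    simp
  refine (hR (.inl (i, ⟨j.val - i.val, hd⟩)) trivial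
    (.inr (⟨k.val - j.val, hkj⟩, ⟨j.val - i.val, hd⟩)) trivial).imp ?_ ?_ <;>
  · intro h v hv
    have := h v hv
    rw [hx, hy] at this
    simp only [convTerm, LinearMap.sub_apply, LinearMap.proj_apply]
    linarith

theorem sortedOn_convTerm {d : ℕ} {R : Set (Fin n ⊕ Fin n → ℝ)}
    (hR : SortedOn (shiftDiff d) Set.univ R) (k : Fin n) {s : Set (Fin n)} (hs : ∀ i ∈ s, i ≤ k)
    (hd : ∀ i ∈ s, ∀ j ∈ s, j.val - i.val < d) : SortedOn (convTerm k) s R := by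
  intro i hi j hj
  rcases le_total i j with hij | hji
  · exact convTerm_total_of_le hR hij (hs j hj) (hd i hi j hj)
  · exact (convTerm_total_of_le hR hji (hs i hi) (hd j hj i hi)).symm

/-- The indices `i ≤ k` in the `t`-th block of length `d`. -/
def block (d : ℕ) (k : Fin n) (t : ℕ) : Finset (Fin n) :=
  (Finset.Iic k).filter fun i => i.val / d = t

theorem exists_least_block {d : ℕ} (hd : 0 < d) {R : Set (Fin n ⊕ Fin n → ℝ)}
    (hR : SortedOn (shiftDiff d) Set.univ R) (k : Fin n) {t : ℕ} (ht : t ≤ k.val / d) :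
    ∃ i ∈ block d k t, ∀ j ∈ block d k t, LEOn R (convTerm k i) (convTerm k j) := by
  refine SortedOn.exists_least (sortedOn_convTerm hR k ?_ ?_) ?_
  · intro i hi
    exact Finset.mem_Iic.mp (Finset.mem_filter.mp hi).1
  · intro i hi j hj
    have h1 := (Finset.mem_filter.mp hi).2
    have h2 := (Finset.mem_filter.mp hj).2
    have h3 := Nat.div_add_mod i.val d
    have h4 := Nat.div_add_mod j.val d
    have h5 := Nat.mod_lt j.val hd
    rw [h1] at h3
    rw [h2] at h4
    omega
  · have h : t * d ≤ k.val := (Nat.le_div_iff_mul_le hd).mp ht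
    exact ⟨⟨t * d, h.trans_lt k.isLt⟩, Finset.mem_filter.mpr
      ⟨Finset.mem_Iic.mpr h, Nat.mul_div_cancel _ hd⟩⟩

theorem computableOn_minSubConvolution_of_sortedOn {d : ℕ} (hd : 0 < d)
    {R : Set (Fin n ⊕ Fin n → ℝ)} (hR : SortedOn (shiftDiff d) Set.univ R) :
    ComputableOn (fun v => minSubConvolution (v ∘ Sum.inl) (v ∘ Sum.inr)) R
      (n * (n / d + 1)) := by
  choose! w hw hmin using fun (k : Fin n) (t : ℕ) (ht : t ≤ k.val / d) =>
    exists_least_block hd hR k ht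
  have := ComputableOn.of_forall_least
    (F := fun v => minSubConvolution (v ∘ Sum.inl) (v ∘ Sum.inr))
    (fun k t => convTerm k (w k t)) (fun k => Finset.range (k.val / d + 1)) (by simp) R
    (c := n / d + 1) (fun k => by simpa using Nat.div_le_div_right k.isLt.le) ?_
  · simpa using this
  intro v hv k t ht hle
  simp only [Finset.mem_range, Nat.lt_succ_iff] at ht hle
  refine minSubConvolution_eq v k _ (Finset.mem_Iic.mp (Finset.mem_filter.mp (hw k t ht)).1) ?_
  intro j hj
  have hjk : j.val / d ≤ k.val / d := Nat.div_le_div_right hj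
  exact (hle _ hjk).trans (hmin k _ hjk j
    (Finset.mem_filter.mpr ⟨Finset.mem_Iic.mpr hj, rfl⟩) v hv)

/-- The crude bound `t ^ 6 ≤ 2 ^ (6 * t)` replaces `log t` by `t`, which is harmless as `n * t` is
the target anyway. -/
theorem log_patternCount_le {t : ℕ} (hn : n ≤ t ^ 2) (R : Set (Fin n ⊕ Fin n → ℝ)) :
    Nat.log 2 (patternCount (shiftDiff (n := n) t) R) ≤ 2 * n * (6 * t + 3) := by
  have hcard := patternCount_le (shiftDiff (n := n) t) R
  simp only [Fintype.card_sum, Fintype.card_prod, Fintype.card_fin] at hcard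
  have hbase : (n * t + n * t) ^ 2 + 1 ≤ 2 ^ (6 * t + 3) := by
    have h1 : n * t + n * t ≤ 2 * t ^ 3 := by nlinarith
    have h2 : t ^ 6 ≤ 2 ^ (6 * t) := by
      rw [mul_comm, pow_mul]
      exact Nat.pow_le_pow_left Nat.lt_two_pow_self.le 6
    calc (n * t + n * t) ^ 2 + 1 ≤ (2 * t ^ 3) ^ 2 + 1 := by gcongr
      _ = 4 * t ^ 6 + 1 := by ring
      _ ≤ 8 * 2 ^ (6 * t) := by
        have := Nat.one_le_two_pow (n := 6 * t)
        omega
      _ = 2 ^ (6 * t + 3) := by ring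
  calc Nat.log 2 (patternCount (shiftDiff (n := n) t) R)
      ≤ Nat.log 2 ((2 ^ (6 * t + 3)) ^ (n + n)) :=
        Nat.log_mono_right (hcard.trans (Nat.pow_le_pow_left hbase _))
    _ = 2 * n * (6 * t + 3) := by
        rw [← pow_mul, Nat.log_pow (by norm_num)]
        ring

theorem computableOn_minSubConvolution (n : ℕ) :
    ComputableOn (fun v : Fin n ⊕ Fin n → ℝ => minSubConvolution (v ∘ Sum.inl) (v ∘ Sum.inr))
      Set.univ (41 * n * (Nat.sqrt n + 1)) := by
  set t := Nat.sqrt n + 1 with ht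
  have hn : n < t * t := Nat.lt_succ_sqrt n
  have ht0 : 0 < t := Nat.succ_pos _
  have hdiv : n / t + 1 ≤ t := Nat.div_lt_of_lt_mul hn
  -- The constant is `41 = 1 + 4 + 36`: selection costs at most `n * t`, the insertions `4 * n * t`,
  -- and the logarithm `4 * n * (6 * t + 3) ≤ 36 * n * t`.
  refine (ComputableOn.of_sorted (f := shiftDiff t) fun R hR =>
    computableOn_minSubConvolution_of_sortedOn ht0 hR).mono subset_rfl ?_
  have hlog := log_patternCount_le (n := n) (t := t) (by nlinarith) Set.univ
  have h1 := Nat.mul_le_mul_left n hdiv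
  have h2 := Nat.mul_le_mul_left n ht0
  simp only [Fintype.card_sum, Fintype.card_prod, Fintype.card_fin]
  nlinarith

end Convolution

theorem mainTheorem5 :
    ∃ C : ℝ, ∀ n : ℕ, ∃ T : LinearDecisionTree (Fin n ⊕ Fin n) (Fin n),
      (∀ (x y : Fin n → ℝ) (k : Fin n),
        T.eval (Sum.elim x y) k = minSubConvolution x y k) ∧
      (T.depth : ℝ) ≤ C * ((n : ℝ) * √(n : ℝ)) := by
  -- `82 = 2 * 41`, since `Nat.sqrt n + 1 ≤ 2 * √n` for `n ≥ 1`.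
  refine ⟨82, fun n => ?_⟩
  obtain ⟨T, hT, hd⟩ := computableOn_minSubConvolution n
  refine ⟨T, fun x y k => ?_, ?_⟩
  · simpa using congrFun (hT (Sum.elim x y) trivial) k
  · have hd' : (T.depth : ℝ) ≤ 41 * n * (Nat.sqrt n + 1) := by exact_mod_cast hd
    rcases n.eq_zero_or_pos with rfl | hn
    · simpa using hd'
    have h1 : (1 : ℝ) ≤ √(n : ℝ) := Real.one_le_sqrt.mpr (by exact_mod_cast hn)
    have h2 : (Nat.sqrt n : ℝ) ≤ √(n : ℝ) := Real.nat_sqrt_le_real_sqrt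
    calc (T.depth : ℝ) ≤ 41 * n * (Nat.sqrt n + 1) := hd'
      _ ≤ 41 * n * (√(n : ℝ) + √(n : ℝ)) := by gcongr
      _ = 82 * (n * √(n : ℝ)) := by ring
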